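/- For real $p,q$ let $$ \begin{aligned} Q_{pq}(t)={}&t^{10}+(2q^2+p^2)(3q^2-2p^2)\,t^8+(q^8+10p^2q^6+4p^4q^4-14p^6q^2+p^8)\,t^6\\ &-p^2q^2(q^8-14p^2q^6+4p^4q^4+10p^6q^2+p^8)\,t^4\\ &-p^6q^6(q^2+2p^2)(3p^2-2q^2)\,t^2-q^{10}p^{10}. \end{aligned} $$ Let $B\in\{1,2,\dots,9\}$, let $\tilde p$ be a negative integer, let $\tilde q$ be a real number with $\tilde q\ge 3600\,\sqrt[3]{|\tilde p|}$, and let $Q_{\tilde p\tilde q}(t)$ be the polynomial obtained from $Q_{pq}(t)$ by substituting $p=B\tilde q^3-\tilde p$, $q=\tilde q$. Then the equation $Q_{\tilde p\tilde q}(t)=0$ has exactly five complex roots $t$ such that either $t$ is real and $t>0$, or $t$ is not real and $\operatorname{Im}t>0$; each of these five roots is simple. Exactly three of them, $t_1,t_2,t_3$, are real (hence positive), and they lie in the intervals $I_1,I_2,I_3$ respectively, where, with $$ \begin{aligned} T_1&=B^2\tilde q^6+2B\tilde q^4-2B\tilde p\tilde q^3-2\tilde q^2-2\tilde p\tilde q+\tilde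 p^2+\frac5B-\frac{20}{B^2\tilde q^2},\\ T_2&=B^2\tilde q^6-2B\tilde q^4-2B\tilde p\tilde q^3-2\tilde q^2+2\tilde p\tilde q+\tilde p^2-\frac5B-\frac{20}{B^2\tilde q^2},\\ T_3&=B\tilde q^4-\tilde p\tilde q+\frac{16}B, \end{aligned} $$ $$ I_1=\Bigl(T_1+\frac{10\tilde p}{B^2\tilde q^3},\,T_1\Bigr),\qquad I_2=\Bigl(T_2,\,T_2-\frac{10\tilde p}{B^2\tilde q^3}\Bigr),\qquad I_3=\Bigl(T_3+\frac{32\tilde p}{B^2\tilde q^3},\,T_3\Bigr). $$ The intervals $I_1,I_2,I_3$ are pairwise disjoint. -/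

import Mathlib

open Polynomial

/-- The tenth degree cuboid polynomial `Q_{pq}(t)` of the second cuboid conjecture, as a
polynomial in `t` with real parameters `p` and `q`. -/
noncomputable def cuboidPoly (p q : ℝ) : ℝ[X] :=
  X ^ 10
    + C ((2 * q ^ 2 + p ^ 2) * (3 * q ^ 2 - 2 * p ^ 2)) * X ^ 8
    + C (q ^ 8 + 10 * p ^ 2 * q ^ 6 + 4 * p ^ 4 * q ^ 4 - 14 * p ^ 6 * q ^ 2 + p ^ 8) * X ^ 6
    - C (p ^ 2 * q ^ 2 *
        (q ^ 8 - 14 * p ^ 2 * q ^ 6 + 4 * p ^ 4 * q ^ 4 + 10 * p ^ 6 * q ^ 2 + p ^ 8)) * X ^ 4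
    - C (p ^ 6 * q ^ 6 * (q ^ 2 + 2 * p ^ 2) * (3 * p ^ 2 - 2 * q ^ 2)) * X ^ 2
    - C (q ^ 10 * p ^ 10)

/-- The cuboid polynomial in the new parameters: the substitution `p = B q̃³ - p̃`, `q = q̃`
in `cuboidPoly p q`. -/
noncomputable def cuboidPolyTilde (B p q : ℝ) : ℝ[X] :=
  cuboidPoly (B * q ^ 3 - p) q

/-- The condition selecting one root of each pair `±t`: `t > 0` if `t` is real, and
`Im t > 0` if `t` is not real. -/
def IsSelected (t : ℂ) : Prop :=
  (t.im = 0 ∧ 0 < t.re) ∨ 0 < t.im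

/-- The set of complex roots of `cuboidPolyTilde B p q` obeying the selection condition. -/
def selectedRoots (B p q : ℝ) : Set ℂ :=
  {t : ℂ | ((cuboidPolyTilde B p q).map (algebraMap ℝ ℂ)).IsRoot t ∧ IsSelected t}

/-- The asymptotic site of the root `t₁` for `p < 0`. -/
def siteOne (B p q : ℝ) : Set ℝ :=
  Set.Ioo
    (B ^ 2 * q ^ 6 + 2 * B * q ^ 4 - 2 * B * p * q ^ 3 - 2 * q ^ 2 - 2 * p * q + p ^ 2 + 5 / B
      - 20 / (B ^ 2 * q ^ 2) + 10 * p / (B ^ 2 * q ^ 3))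
    (B ^ 2 * q ^ 6 + 2 * B * q ^ 4 - 2 * B * p * q ^ 3 - 2 * q ^ 2 - 2 * p * q + p ^ 2 + 5 / B
      - 20 / (B ^ 2 * q ^ 2))

/-- The asymptotic site of the root `t₂` for `p < 0`. -/
def siteTwo (B p q : ℝ) : Set ℝ :=
  Set.Ioo
    (B ^ 2 * q ^ 6 - 2 * B * q ^ 4 - 2 * B * p * q ^ 3 - 2 * q ^ 2 + 2 * p * q + p ^ 2 - 5 / B
      - 20 / (B ^ 2 * q ^ 2))
    (B ^ 2 * q ^ 6 - 2 * B * q ^ 4 - 2 * B * p * q ^ 3 - 2 * q ^ 2 + 2 * p * q + p ^ 2 - 5 / B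
      - 20 / (B ^ 2 * q ^ 2) - 10 * p / (B ^ 2 * q ^ 3))

/-- The asymptotic site of the root `t₃` for `p < 0`. -/
def siteThree (B p q : ℝ) : Set ℝ :=
  Set.Ioo
    (B * q ^ 4 - p * q + 16 / B + 32 * p / (B ^ 2 * q ^ 3))
    (B * q ^ 4 - p * q + 16 / B)

/-! Giving `p` and `q` weight 1 and `t` weight 2 makes the polynomial homogeneous of degree 20. With
P = B q³ - p and x = q/P, everything reduces to `cuboidPoly 1 x`, where x is positive and at most
10⁻⁶. At x = 0 that polynomial is τ⁶(τ² - 1)², so its positive roots can be followed as series in x: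
two leave 1 as 1 ± 2x + ..., and one leaves 0 as x + 16x³ + .... Two more pairs are purely
imaginary, of size about (√2 ± 1)x².

Truncated series bracket each real root: moving the next coefficient from 0 to 100 changes the sign
of the value. The imaginary roots come from sign changes of `cuboidImag`. By evenness in t this
gives ten distinct roots, the full degree, so there are no others and all are simple
(`cuboidPoly_map_roots_eq`).

Finally, P² times the truncated series is compared with the stated endpoints (`expansion_bounds`).
The error unit is δ = -p/(B²q³), which comes from replacing q³/P by 1/B. -/

/-! ### Sign of a polynomial at a small argument -/

/-- Evaluation of the real polynomial whose coefficients, from degree zero upwards, are listed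
in `l`, by Horner's scheme. -/
def hornerEval (l : List ℝ) (x : ℝ) : ℝ :=
  l.foldr (fun c h => c + x * h) 0

theorem abs_hornerEval_le {x ε : ℝ} (hx : |x| ≤ ε) (l : List ℝ) :
    |hornerEval l x| ≤ hornerEval (l.map abs) ε := by
  induction l with
  | nil => simp [hornerEval]
  | cons c l ih =>
    simp only [hornerEval, List.map_cons, List.foldr_cons] at ih ⊢
    refine (abs_add_le _ _).trans ?_
    rw [abs_mul]
    gcongr
    exact (abs_nonneg x).trans hx

/-- The constant term dominates: the rest is at most its value at ε with absolute coefficients, so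
positivity becomes one rational inequality. -/
theorem hornerEval_cons_pos {x ε c : ℝ} {l : List ℝ} (hx : |x| ≤ ε)
    (h : ε * hornerEval (l.map abs) ε < c) : 0 < hornerEval (c :: l) x := by
  have hle : |x * hornerEval l x| ≤ ε * hornerEval (l.map abs) ε := by
    rw [abs_mul]
    exact mul_le_mul hx (abs_hornerEval_le hx l) (abs_nonneg _) ((abs_nonneg x).trans hx)
  have := (abs_le.1 hle).1
  simp only [hornerEval, List.foldr_cons] at this h ⊢
  linarith

theorem hornerEval_cons_neg {x ε c : ℝ} {l : List ℝ} (hx : |x| ≤ ε)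
    (h : ε * hornerEval (l.map abs) ε < -c) : hornerEval (c :: l) x < 0 := by
  have hle : |x * hornerEval l x| ≤ ε * hornerEval (l.map abs) ε := by
    rw [abs_mul]
    exact mul_le_mul hx (abs_hornerEval_le hx l) (abs_nonneg _) ((abs_nonneg x).trans hx)
  have := (abs_le.1 hle).2
  simp only [hornerEval, List.foldr_cons] at this h ⊢
  linarith

/-! ### Scaling and brackets for the real roots -/

theorem cuboidPoly_eval (p q t : ℝ) :
    (cuboidPoly p q).eval t =
      t ^ 10 + (2 * q ^ 2 + p ^ 2) * (3 * q ^ 2 - 2 * p ^ 2) * t ^ 8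
      + (q ^ 8 + 10 * p ^ 2 * q ^ 6 + 4 * p ^ 4 * q ^ 4 - 14 * p ^ 6 * q ^ 2 + p ^ 8) * t ^ 6
      - p ^ 2 * q ^ 2 *
        (q ^ 8 - 14 * p ^ 2 * q ^ 6 + 4 * p ^ 4 * q ^ 4 + 10 * p ^ 6 * q ^ 2 + p ^ 8) * t ^ 4
      - p ^ 6 * q ^ 6 * (q ^ 2 + 2 * p ^ 2) * (3 * p ^ 2 - 2 * q ^ 2) * t ^ 2
      - q ^ 10 * p ^ 10 := by
  simp [cuboidPoly]

theorem cuboidPoly_eval_homogeneous (p x τ : ℝ) :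
    (cuboidPoly p (p * x)).eval (p ^ 2 * τ) = p ^ 20 * (cuboidPoly 1 x).eval τ := by
  simp only [cuboidPoly_eval]
  ring

/-- The truncated expansion, for small `x`, of the root of `cuboidPoly 1 x` near `1`, with the
coefficient `k` of `x ^ 5` left free. -/
def nearOne (k x : ℝ) : ℝ :=
  1 + 2 * x - 2 * x ^ 2 + 5 * x ^ 3 - 20 * x ^ 4 + k * x ^ 5

/-- The truncated expansion, for small `x`, of the root of `cuboidPoly 1 x` near `x`, with the
coefficient `k` of `x ^ 5` left free. -/
def nearZero (k x : ℝ) : ℝ :=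
  x * (1 + 16 * x ^ 2 + k * x ^ 4)

/-- The series up to x⁴ cancels all orders below x⁶. The x⁶ coefficient is then 16k - 1228, so the
true fifth coefficient, 76.75, lies between 0 and 100. -/
theorem cuboidPoly_eval_nearOne_neg {x : ℝ} (hx0 : x ≠ 0) (hx : |x| ≤ 1 / 1000000) :
    (cuboidPoly 1 x).eval (nearOne 0 x) < 0 := by
  have key : (cuboidPoly 1 x).eval (nearOne 0 x) = x ^ 6 * hornerEval
      [-1228, -11976, -35460, -32140, 59944, 905572, 2651661, 921092, -649829, -31715350,
      -92891182, 44560724, -106046235, 804210628, 1860215219, -3128461640, 7644772395,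
      -23131511450, -6631354075, 54365223000, -197930809000, 580638931250, -775459856250,
      810712487500, 182906815625, -4174874625000, 10622743250000, -21464920000000,
      35575880000000, -46219200000000, 54121600000000, -52480000000000, 39040000000000,
      -25600000000000, 10240000000000] x := by
    simp only [cuboidPoly_eval, nearOne, hornerEval, List.foldr_cons, List.foldr_nil]
    ring
  rw [key]
  refine mul_neg_of_pos_of_neg (by positivity) (hornerEval_cons_neg hx ?_)
  simp only [hornerEval, List.map_cons, List.map_nil, List.foldr_cons, List.foldr_nil]
  norm_num

theorem cuboidPoly_eval_nearOne_pos {x : ℝ} (hx0 : x ≠ 0) (hx : |x| ≤ 1 / 1000000) :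
    0 < (cuboidPoly 1 x).eval (nearOne 100 x) := by
  have key : (cuboidPoly 1 x).eval (nearOne 100 x) = x ^ 6 * hornerEval
      [372, 10424, 75740, 198260, 159944, -84428, 2937261, 31075892, 72815371, 24406250,
      -54272382, 196989724, 6265738965, 11169883028, -3410504581, 847405960, -59012244805,
      909887908950, 582146955925, -668378910000, 1950272931000, -18104315058750,
      115550847218750, -108953755387500, 182875941815625, -165766335875000, -1446272473625000,
      10179749907500000, -23326050838750000, 56198315000000000, -121516739400000000,
      171755576000000000, 37003685000000000, -691522600000000000, 2849283240000000000,
      -8679052000000000000, 20859170000000000000, -40737600000000000000, 75024000000000000000,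
      -123464000000000000000, 172850000000000000000, -206000000000000000000,
      230000000000000000000, -200000000000000000000, 100000000000000000000] x := by
    simp only [cuboidPoly_eval, nearOne, hornerEval, List.foldr_cons, List.foldr_nil]
    ring
  rw [key]
  refine mul_pos (by positivity) (hornerEval_cons_pos hx ?_)
  simp only [hornerEval, List.map_cons, List.map_nil, List.foldr_cons, List.foldr_nil]
  norm_num

/-- Here the leading coefficient, at x¹⁰, is 2k - 128, which vanishes at k = 64, again between 0 and
100. -/
theorem cuboidPoly_eval_nearZero_neg {x : ℝ} (hx0 : x ≠ 0) (hx : |x ^ 2| ≤ 1 / 1000000) :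
    (cuboidPoly 1 x).eval (nearZero 0 x) < 0 := by
  have key : (cuboidPoly 1 x).eval (nearZero 0 x) = x ^ 10 * hornerEval
      [-128, -19232, -835456, -16673760, -173471488, -905379840, -758251520, 24467472384,
      201880240128, 712964571136, 1099511627776] (x ^ 2) := by
    simp only [cuboidPoly_eval, nearZero, hornerEval, List.foldr_cons, List.foldr_nil]
    ring
  rw [key]
  refine mul_neg_of_pos_of_neg (by positivity) (hornerEval_cons_neg hx ?_)
  simp only [hornerEval, List.map_cons, List.map_nil, List.foldr_cons, List.foldr_nil]
  norm_num

theorem cuboidPoly_eval_nearZero_pos {x : ℝ} (hx0 : x ≠ 0) (hx : |x ^ 2| ≤ 1 / 1000000) :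
    0 < (cuboidPoly 1 x).eval (nearZero 100 x) := by
  have key : (cuboidPoly 1 x).eval (nearZero 100 x) = x ^ 10 * hornerEval
      [72, -5632, -577856, -22364160, -531344088, -8874661440, -109939819120, -1017159279616,
      -6570650550272, -18764212414464, 193592613080576, 3766034505216000, 37250058259200000,
      267378222720000000, 1498206696000000000, 6674059520000000000, 23495360000000000000,
      63612000000000000000, 125200000000000000000, 160000000000000000000, 100000000000000000000] (x ^ 2) := by
    simp only [cuboidPoly_eval, nearZero, hornerEval, List.foldr_cons, List.foldr_nil]
    ring
  rw [key]
  refine mul_pos (by positivity) (hornerEval_cons_pos hx ?_)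
  simp only [hornerEval, List.map_cons, List.map_nil, List.foldr_cons, List.foldr_nil]
  norm_num

theorem cuboidPoly_eval_neg_right (p q t : ℝ) :
    (cuboidPoly p (-q)).eval t = (cuboidPoly p q).eval t := by
  simp only [cuboidPoly_eval]
  ring

theorem cuboidPoly_eval_neg (p q t : ℝ) :
    (cuboidPoly p q).eval (-t) = (cuboidPoly p q).eval t := by
  simp only [cuboidPoly_eval]
  ring

/-! ### Purely imaginary roots -/

/-- The value of `cuboidPoly p q` at the purely imaginary point `y * I`. -/
def cuboidImag (p q y : ℝ) : ℝ :=
  -y ^ 10 + (2 * q ^ 2 + p ^ 2) * (3 * q ^ 2 - 2 * p ^ 2) * y ^ 8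
  - (q ^ 8 + 10 * p ^ 2 * q ^ 6 + 4 * p ^ 4 * q ^ 4 - 14 * p ^ 6 * q ^ 2 + p ^ 8) * y ^ 6
  - p ^ 2 * q ^ 2 *
    (q ^ 8 - 14 * p ^ 2 * q ^ 6 + 4 * p ^ 4 * q ^ 4 + 10 * p ^ 6 * q ^ 2 + p ^ 8) * y ^ 4
  + p ^ 6 * q ^ 6 * (q ^ 2 + 2 * p ^ 2) * (3 * p ^ 2 - 2 * q ^ 2) * y ^ 2
  - q ^ 10 * p ^ 10

theorem cuboidPoly_map_eval_ofReal (p q t : ℝ) :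
    ((cuboidPoly p q).map (algebraMap ℝ ℂ)).eval (t : ℂ) = ((cuboidPoly p q).eval t : ℝ) := by
  have := eval_map_apply (p := cuboidPoly p q) (f := algebraMap ℝ ℂ) t
  simpa using this

theorem cuboidPoly_map_eval_mul_I (p q y : ℝ) :
    ((cuboidPoly p q).map (algebraMap ℝ ℂ)).eval (y * Complex.I) = (cuboidImag p q y : ℝ) := by
  have h2 : ((y : ℂ) * Complex.I) ^ 2 = -(y : ℂ) ^ 2 := by
    rw [mul_pow, Complex.I_sq]; ring
  have h4 : ((y : ℂ) * Complex.I) ^ 4 = (y : ℂ) ^ 4 := by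
    rw [mul_pow, Complex.I_pow_four]; ring
  have h6 : ((y : ℂ) * Complex.I) ^ 6 = -(y : ℂ) ^ 6 := by
    rw [show 6 = 2 * 3 from rfl, pow_mul, h2]; ring
  have h8 : ((y : ℂ) * Complex.I) ^ 8 = (y : ℂ) ^ 8 := by
    rw [show 8 = 4 * 2 from rfl, pow_mul, h4]; ring
  have h10 : ((y : ℂ) * Complex.I) ^ 10 = -(y : ℂ) ^ 10 := by
    rw [show 10 = 2 * 5 from rfl, pow_mul, h2]; ring
  simp only [cuboidPoly, Polynomial.map_add, Polynomial.map_sub, Polynomial.map_mul,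
    Polynomial.map_pow, map_X, map_C, eval_add, eval_sub, eval_mul, eval_pow, eval_X, eval_C,
    h2, h4, h6, h8, h10, cuboidImag, Complex.coe_algebraMap]
  push_cast
  ring

theorem cuboidImag_homogeneous (p x η : ℝ) :
    cuboidImag p (p * x) (p ^ 2 * η) = p ^ 20 * cuboidImag 1 x η := by
  simp only [cuboidImag]
  ring

/-- At η = c x² the leading part is (-c⁴ + 6c² - 1)x¹⁰, with positive zeros c = √2 ± 1. The values c
= 0, 1, 3 separate them. -/
theorem cuboidImag_sq_pos {x : ℝ} (hx0 : x ≠ 0) (hx : |x ^ 2| ≤ 1 / 1000000) :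
    0 < cuboidImag 1 x (x ^ 2) := by
  have key : cuboidImag 1 x (x ^ 2) = x ^ 10 * hornerEval [4, -12, 8, 8, -12, 4] (x ^ 2) := by
    simp only [cuboidImag, hornerEval, List.foldr_cons, List.foldr_nil]
    ring
  rw [key]
  refine mul_pos (by positivity) (hornerEval_cons_pos hx ?_)
  simp only [hornerEval, List.map_cons, List.map_nil, List.foldr_cons, List.foldr_nil]
  norm_num

theorem cuboidImag_three_mul_sq_neg {x : ℝ} (hx0 : x ≠ 0) (hx : |x ^ 2| ≤ 1 / 1000000) :
    cuboidImag 1 x (3 * x ^ 2) < 0 := by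
  have key : cuboidImag 1 x (3 * x ^ 2) = x ^ 10 * hornerEval
      [-28, -1548, 9864, -14904, -13932, -20412] (x ^ 2) := by
    simp only [cuboidImag, hornerEval, List.foldr_cons, List.foldr_nil]
    ring
  rw [key]
  refine mul_neg_of_pos_of_neg (by positivity) (hornerEval_cons_neg hx ?_)
  simp only [hornerEval, List.map_cons, List.map_nil, List.foldr_cons, List.foldr_nil]
  norm_num

/-! ### Ten distinct roots exhaust the degree -/

theorem cuboidPoly_natDegree (p q : ℝ) : (cuboidPoly p q).natDegree = 10 := by
  unfold cuboidPoly
  compute_degree!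

theorem cuboidPoly_ne_zero (p q : ℝ) : cuboidPoly p q ≠ 0 := by
  intro h
  simpa [h] using cuboidPoly_natDegree p q

theorem roots_eq_val_of_card_le {R : Type*} [CommRing R] [IsDomain R] {f : R[X]} (hf : f ≠ 0)
    {Z : Finset R} (hZ : ∀ z ∈ Z, f.IsRoot z) (hcard : f.natDegree ≤ Z.card) :
    f.roots = Z.val := by
  refine (Multiset.eq_of_le_of_card_le ?_ ((card_roots' f).trans hcard)).symm
  exact (Multiset.le_iff_subset Z.nodup).2 fun z hz => (mem_roots hf).2 (hZ z hz)

/-- A continuous function with values of opposite sign at `a` and `b` vanishes between them. -/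
theorem exists_zero_Ioo {f : ℝ → ℝ} (hf : Continuous f) {a b : ℝ} (hab : a ≤ b)
    (h : (f a < 0 ∧ 0 < f b) ∨ (0 < f a ∧ f b < 0)) : ∃ t ∈ Set.Ioo a b, f t = 0 := by
  rcases h with h | h
  · exact intermediate_value_Ioo hab hf.continuousOn h
  · exact intermediate_value_Ioo' hab hf.continuousOn ⟨h.2, h.1⟩

/-- The ten points `±t₁, ±t₂, ±t₃, ±y₁ I, ±y₂ I` of the complex plane. -/
noncomputable def tenPoints (t₁ t₂ t₃ y₁ y₂ : ℝ) : Finset ℂ :=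
  {(t₁ : ℂ), -(t₁ : ℂ), (t₂ : ℂ), -(t₂ : ℂ), (t₃ : ℂ), -(t₃ : ℂ),
    y₁ * Complex.I, -(y₁ * Complex.I), y₂ * Complex.I, -(y₂ * Complex.I)}

theorem card_tenPoints {t₁ t₂ t₃ y₁ y₂ : ℝ} (h3 : 0 < t₃) (h32 : t₃ < t₂) (h21 : t₂ < t₁)
    (hy1 : 0 < y₁) (hy : y₁ < y₂) : (tenPoints t₁ t₂ t₃ y₁ y₂).card = 10 := by
  unfold tenPoints
  repeat rw [Finset.card_insert_of_notMem]
  · simp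
  all_goals
    simp only [Finset.mem_insert, Finset.mem_singleton, Complex.ext_iff, Complex.neg_re,
      Complex.neg_im, Complex.ofReal_re, Complex.ofReal_im, Complex.re_ofReal_mul,
      Complex.im_ofReal_mul, Complex.I_re, Complex.I_im, not_or, not_and_or]
    grind

section

variable {p q t₁ t₂ t₃ y₁ y₂ : ℝ}

theorem cuboidPoly_map_roots_eq (h3 : 0 < t₃) (h32 : t₃ < t₂) (h21 : t₂ < t₁)
    (hy1 : 0 < y₁) (hy : y₁ < y₂) (e₁ : (cuboidPoly p q).eval t₁ = 0)
    (e₂ : (cuboidPoly p q).eval t₂ = 0) (e₃ : (cuboidPoly p q).eval t₃ = 0)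
    (f₁ : cuboidImag p q y₁ = 0) (f₂ : cuboidImag p q y₂ = 0) :
    ((cuboidPoly p q).map (algebraMap ℝ ℂ)).roots = (tenPoints t₁ t₂ t₃ y₁ y₂).val := by
  have hreal : ∀ t : ℝ, (cuboidPoly p q).eval t = 0 →
      ((cuboidPoly p q).map (algebraMap ℝ ℂ)).IsRoot t := fun t ht => by
    rw [IsRoot.def, cuboidPoly_map_eval_ofReal, ht, Complex.ofReal_zero]
  have himag : ∀ y : ℝ, cuboidImag p q y = 0 →
      ((cuboidPoly p q).map (algebraMap ℝ ℂ)).IsRoot (y * Complex.I) := fun y hy => by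
    rw [IsRoot.def, cuboidPoly_map_eval_mul_I, hy, Complex.ofReal_zero]
  have hrneg : ∀ t : ℝ, (cuboidPoly p q).eval t = 0 →
      ((cuboidPoly p q).map (algebraMap ℝ ℂ)).IsRoot (-t) := fun t ht => by
    simpa using hreal (-t) (by rw [cuboidPoly_eval_neg, ht])
  have hineg : ∀ y : ℝ, cuboidImag p q y = 0 →
      ((cuboidPoly p q).map (algebraMap ℝ ℂ)).IsRoot (-(y * Complex.I)) := fun y hy => by
    have : cuboidImag p q (-y) = 0 := by rw [← hy]; simp only [cuboidImag]; ring
    simpa using himag (-y) this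
  refine roots_eq_val_of_card_le ((Polynomial.map_ne_zero_iff (algebraMap ℝ ℂ).injective).2
    (cuboidPoly_ne_zero p q)) ?_ ?_
  · intro z hz
    simp only [tenPoints, Finset.mem_insert, Finset.mem_singleton] at hz
    rcases hz with rfl | rfl | rfl | rfl | rfl | rfl | rfl | rfl | rfl | rfl
    exacts [hreal _ e₁, hrneg _ e₁, hreal _ e₂, hrneg _ e₂, hreal _ e₃, hrneg _ e₃,
      himag _ f₁, hineg _ f₁, himag _ f₂, hineg _ f₂]
  · rw [natDegree_map, cuboidPoly_natDegree, card_tenPoints h3 h32 h21 hy1 hy]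

theorem tenPoints_filter_isSelected (h3 : 0 < t₃) (h32 : t₃ < t₂) (h21 : t₂ < t₁)
    (hy1 : 0 < y₁) (hy : y₁ < y₂) :
    {t : ℂ | t ∈ tenPoints t₁ t₂ t₃ y₁ y₂ ∧ IsSelected t} =
      (({(t₁ : ℂ), (t₂ : ℂ), (t₃ : ℂ), y₁ * Complex.I, y₂ * Complex.I} : Finset ℂ) : Set ℂ) := by
  ext z
  simp only [Set.mem_ofPred_eq, Finset.mem_coe, tenPoints, IsSelected, Finset.mem_insert,
    Finset.mem_singleton, Complex.ext_iff, Complex.neg_re, Complex.neg_im, Complex.ofReal_re,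
    Complex.ofReal_im, Complex.re_ofReal_mul, Complex.im_ofReal_mul, Complex.I_re, Complex.I_im]
  grind

theorem card_selected_tenPoints (h3 : 0 < t₃) (h32 : t₃ < t₂) (h21 : t₂ < t₁)
    (hy : y₁ < y₂) :
    ({(t₁ : ℂ), (t₂ : ℂ), (t₃ : ℂ), y₁ * Complex.I, y₂ * Complex.I} : Finset ℂ).card = 5 := by
  repeat rw [Finset.card_insert_of_notMem]
  · simp
  all_goals
    simp only [Finset.mem_insert, Finset.mem_singleton, Complex.ext_iff, Complex.ofReal_re,
      Complex.ofReal_im, Complex.re_ofReal_mul,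
      Complex.im_ofReal_mul, Complex.I_re, Complex.I_im, not_or, not_and_or]
    grind

theorem setOf_pos_isRoot_eq (h3 : 0 < t₃) (h32 : t₃ < t₂) (h21 : t₂ < t₁)
    (hroots : ((cuboidPoly p q).map (algebraMap ℝ ℂ)).roots = (tenPoints t₁ t₂ t₃ y₁ y₂).val) :
    {t : ℝ | 0 < t ∧ (cuboidPoly p q).IsRoot t} = {t₁, t₂, t₃} := by
  ext t
  have h : (cuboidPoly p q).IsRoot t ↔ (t : ℂ) ∈ tenPoints t₁ t₂ t₃ y₁ y₂ := by
    rw [← Finset.mem_val, ← hroots, mem_roots ((Polynomial.map_ne_zero_iff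
      (algebraMap ℝ ℂ).injective).2 (cuboidPoly_ne_zero p q)), IsRoot.def, IsRoot.def,
      cuboidPoly_map_eval_ofReal, Complex.ofReal_eq_zero]
  simp only [Set.mem_ofPred_eq, h, tenPoints, Finset.mem_insert, Finset.mem_singleton,
    Set.mem_insert_iff, Set.mem_singleton_iff, Complex.ext_iff, Complex.neg_re,
    Complex.neg_im, Complex.ofReal_re, Complex.ofReal_im, Complex.re_ofReal_mul,
    Complex.im_ofReal_mul, Complex.I_re, Complex.I_im]
  grind

end

/-! ### Existence of the roots by sign changes -/

/-- The three positive roots of `cuboidPoly p q` and the two roots of `cuboidImag p q`, located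
for `q` small in comparison with `p`. -/
theorem exists_cuboidPoly_roots {p x : ℝ} (hp : 0 < p) (hx0 : 0 < x) (hx : x ≤ 1 / 1000000) :
    ∃ t₁ t₂ t₃ y₁ y₂ : ℝ,
      t₁ ∈ Set.Ioo (p ^ 2 * nearOne 0 x) (p ^ 2 * nearOne 100 x) ∧
      t₂ ∈ Set.Ioo (p ^ 2 * nearOne 100 (-x)) (p ^ 2 * nearOne 0 (-x)) ∧
      t₃ ∈ Set.Ioo (p ^ 2 * nearZero 0 x) (p ^ 2 * nearZero 100 x) ∧
      0 < y₁ ∧ y₁ < y₂ ∧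
      (cuboidPoly p (p * x)).eval t₁ = 0 ∧ (cuboidPoly p (p * x)).eval t₂ = 0 ∧
      (cuboidPoly p (p * x)).eval t₃ = 0 ∧
      cuboidImag p (p * x) y₁ = 0 ∧ cuboidImag p (p * x) y₂ = 0 := by
  have hxa : |x| ≤ 1 / 1000000 := by rwa [abs_of_pos hx0]
  have hxn : |-x| ≤ 1 / 1000000 := by rwa [abs_neg]
  have hx2 : |x ^ 2| ≤ 1 / 1000000 := by
    rw [abs_of_pos (by positivity)]
    nlinarith
  have hc : Continuous fun t => (cuboidPoly p (p * x)).eval t := (cuboidPoly p (p * x)).continuous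
  have hci : Continuous fun y => cuboidImag p (p * x) y := by
    unfold cuboidImag
    fun_prop
  have hp20 : 0 < p ^ 20 := by positivity
  have hx5 : 0 < x ^ 5 := by positivity
  obtain ⟨t₁, ht₁, e₁⟩ := exists_zero_Ioo hc (a := p ^ 2 * nearOne 0 x)
    (b := p ^ 2 * nearOne 100 x) (by unfold nearOne; gcongr; norm_num) (Or.inl (by
      simp only [cuboidPoly_eval_homogeneous]
      exact ⟨mul_neg_of_pos_of_neg hp20 (cuboidPoly_eval_nearOne_neg hx0.ne' hxa),
        mul_pos hp20 (cuboidPoly_eval_nearOne_pos hx0.ne' hxa)⟩))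
  -- Evenness in `q` turns the branch 1 - 2x + ... into the first one at -x; the odd power x⁵
  -- reverses the endpoints.
  obtain ⟨t₂, ht₂, e₂⟩ := exists_zero_Ioo hc (a := p ^ 2 * nearOne 100 (-x))
    (b := p ^ 2 * nearOne 0 (-x))
    (mul_le_mul_of_nonneg_left (by unfold nearOne; linarith [Odd.neg_pow (n := 5) (by decide) x])
      (by positivity)) (Or.inr (by
      simp only [cuboidPoly_eval_homogeneous, ← cuboidPoly_eval_neg_right 1 x]
      exact ⟨mul_pos hp20 (cuboidPoly_eval_nearOne_pos (neg_ne_zero.2 hx0.ne') hxn),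
        mul_neg_of_pos_of_neg hp20 (cuboidPoly_eval_nearOne_neg (neg_ne_zero.2 hx0.ne') hxn)⟩))
  obtain ⟨t₃, ht₃, e₃⟩ := exists_zero_Ioo hc (a := p ^ 2 * nearZero 0 x)
    (b := p ^ 2 * nearZero 100 x) (by unfold nearZero; gcongr; norm_num) (Or.inl (by
      simp only [cuboidPoly_eval_homogeneous]
      exact ⟨mul_neg_of_pos_of_neg hp20 (cuboidPoly_eval_nearZero_neg hx0.ne' hx2),
        mul_pos hp20 (cuboidPoly_eval_nearZero_pos hx0.ne' hx2)⟩))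
  have hmid : 0 < cuboidImag p (p * x) (p ^ 2 * x ^ 2) := by
    rw [cuboidImag_homogeneous]
    exact mul_pos hp20 (cuboidImag_sq_pos hx0.ne' hx2)
  have hhigh : cuboidImag p (p * x) (p ^ 2 * (3 * x ^ 2)) < 0 := by
    rw [cuboidImag_homogeneous]
    exact mul_neg_of_pos_of_neg hp20 (cuboidImag_three_mul_sq_neg hx0.ne' hx2)
  have hlow : cuboidImag p (p * x) 0 < 0 := by
    have : 0 < (p * x) ^ 10 * p ^ 10 := by positivity
    simpa [cuboidImag] using this
  obtain ⟨y₁, hy₁, f₁⟩ := exists_zero_Ioo hci (by positivity) (Or.inl ⟨hlow, hmid⟩)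
  obtain ⟨y₂, hy₂, f₂⟩ := exists_zero_Ioo hci
    (mul_le_mul_of_nonneg_left (by nlinarith) (by positivity)) (Or.inr ⟨hmid, hhigh⟩)
  exact ⟨t₁, t₂, t₃, y₁, y₂, ht₁, ht₂, ht₃, hy₁.1, hy₁.2.trans hy₂.1, e₁, e₂, e₃, f₁, f₂⟩

/-! ### From the series in q/P to the stated intervals -/

/-- Bounds for the terms of the expansions of the roots in powers of `q`. -/
theorem expansion_bounds {b r q : ℝ} (hb : 1 ≤ b) (hr : 1 ≤ r) (hq : 3600 ≤ q)
    (hqr : 3600 * r ≤ q ^ 3) :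
    1 / b - r / (b ^ 2 * q ^ 3) < q ^ 3 / (b * q ^ 3 + r) ∧
    q ^ 3 / (b * q ^ 3 + r) < 1 / b - r / (b ^ 2 * q ^ 3) / 2 ∧
    1 / (b ^ 2 * q ^ 2) - r / (b ^ 2 * q ^ 3) / 1000 < q ^ 4 / (b * q ^ 3 + r) ^ 2 ∧
    q ^ 4 / (b * q ^ 3 + r) ^ 2 < 1 / (b ^ 2 * q ^ 2) ∧
    q ^ 5 / (b * q ^ 3 + r) ^ 3 < r / (b ^ 2 * q ^ 3) / 1000 := by
  have hq0 : 0 < q := by linarith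
  have hb0 : 0 < b := by linarith
  have hr0 : 0 < r := by linarith
  have hq3 : 0 < q ^ 3 := by positivity
  have hP : 0 < b * q ^ 3 + r := by positivity
  have hbq : q ^ 3 ≤ b * q ^ 3 := by nlinarith
  have hlow : 1 / b - r / (b ^ 2 * q ^ 3) < q ^ 3 / (b * q ^ 3 + r) := by
    rw [← sub_pos]
    have : q ^ 3 / (b * q ^ 3 + r) - (1 / b - r / (b ^ 2 * q ^ 3)) =
        r ^ 2 / (b ^ 2 * q ^ 3 * (b * q ^ 3 + r)) := by
      field_simp
      ring
    rw [this]
    positivity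
  have hup : q ^ 3 / (b * q ^ 3 + r) < 1 / b - r / (b ^ 2 * q ^ 3) / 2 := by
    rw [← sub_pos]
    have : 1 / b - r / (b ^ 2 * q ^ 3) / 2 - q ^ 3 / (b * q ^ 3 + r) =
        r * (b * q ^ 3 - r) / (2 * (b ^ 2 * q ^ 3 * (b * q ^ 3 + r))) := by
      field_simp
      ring
    rw [this]
    have : 0 < b * q ^ 3 - r := by linarith
    positivity
  refine ⟨hlow, hup, ?_, ?_, ?_⟩
  · have hs : 1 / b ^ 2 - 2 * (r / (b ^ 2 * q ^ 3)) < (q ^ 3 / (b * q ^ 3 + r)) ^ 2 := by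
      have h1 : 1 / b ≤ 1 := by rw [div_le_one hb0]; exact hb
      have h2 : 0 < r / (b ^ 2 * q ^ 3) := by positivity
      have h3 : r / (b ^ 2 * q ^ 3) < 1 / b := by
        have : 0 < q ^ 3 / (b * q ^ 3 + r) := by positivity
        have : r / (b ^ 2 * q ^ 3) / 2 < 1 / b := by linarith
        rw [div_lt_div_iff₀ (by positivity) hb0]
        nlinarith [mul_pos hb0 hq3]
      have h4 : (1 / b) ^ 2 = 1 / b ^ 2 := by simp
      nlinarith
    have e1 : q ^ 4 / (b * q ^ 3 + r) ^ 2 = (q ^ 3 / (b * q ^ 3 + r)) ^ 2 * (1 / q ^ 2) := by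
      field_simp
    have e2 : 1 / (b ^ 2 * q ^ 2) = 1 / b ^ 2 * (1 / q ^ 2) := by field_simp
    -- Squaring `hlow` costs 2δ; a factor 1/2000 brings this down to δ/1000.
    have h5 : 1 / q ^ 2 ≤ 1 / 2000 := by
      apply one_div_le_one_div_of_le <;> nlinarith
    have h6 : 0 < 1 / q ^ 2 := by positivity
    have h7 : 0 < r / (b ^ 2 * q ^ 3) := by positivity
    rw [e1, e2]
    nlinarith [mul_lt_mul_of_pos_right hs h6, mul_le_mul_of_nonneg_left h5 h7.le]
  · rw [div_lt_div_iff₀ (by positivity) (by positivity)]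
    nlinarith [mul_pos hr0 (mul_pos hb0 hq3)]
  · rw [div_div, div_lt_div_iff₀ (by positivity) (by positivity)]
    have h1 : (b * q ^ 3) ^ 3 < (b * q ^ 3 + r) ^ 3 := by gcongr; linarith
    have h2 : q ^ 5 * (b ^ 2 * q ^ 3 * 1000) ≤ (b * q ^ 3) ^ 3 := by
      have : q ^ 5 * (b ^ 2 * q ^ 3 * 1000) = b ^ 2 * q ^ 8 * 1000 := by ring
      rw [this, show (b * q ^ 3) ^ 3 = b ^ 2 * q ^ 8 * (b * q) by ring]
      gcongr
      nlinarith
    calc _ ≤ (b * q ^ 3) ^ 3 := h2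
      _ < (b * q ^ 3 + r) ^ 3 := h1
      _ ≤ r * (b * q ^ 3 + r) ^ 3 := le_mul_of_one_le_left (by positivity) hr

section

variable {b p q : ℝ}

theorem sq_mul_nearOne {P q : ℝ} (hP : P ≠ 0) (k : ℝ) :
    P ^ 2 * nearOne k (q / P) = P ^ 2 + 2 * P * q - 2 * q ^ 2 + 5 * (q ^ 3 / P)
      - 20 * (q ^ 4 / P ^ 2) + k * (q ^ 5 / P ^ 3) := by
  unfold nearOne
  field_simp

theorem sq_mul_nearZero {P q : ℝ} (hP : P ≠ 0) (k : ℝ) :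
    P ^ 2 * nearZero k (q / P) = P * q + 16 * (q ^ 3 / P) + k * (q ^ 5 / P ^ 3) := by
  unfold nearZero
  field_simp

/-- The term 5q³/P falls short of 5/b by between 2.5δ and 5δ. The fourth and fifth order terms add
at most 0.12δ, so the bracket stays inside the interval of width 10δ. -/
theorem Ioo_subset_siteOne (hb : 1 ≤ b) (hp : p ≤ -1) (hq : 3600 ≤ q)
    (hqp : 3600 * -p ≤ q ^ 3) :
    Set.Ioo ((b * q ^ 3 - p) ^ 2 * nearOne 0 (q / (b * q ^ 3 - p)))
      ((b * q ^ 3 - p) ^ 2 * nearOne 100 (q / (b * q ^ 3 - p))) ⊆ siteOne b p q := by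
  have hq0 : 0 < q := by linarith
  have hP : 0 < b * q ^ 3 - p := by nlinarith [pow_pos hq0 3]
  obtain ⟨h1, h2, h3, h4, h5⟩ := expansion_bounds hb (by linarith : 1 ≤ -p) hq hqp
  rw [← sub_eq_add_neg] at h1 h2 h3 h4 h5
  have hδ : 10 * p / (b ^ 2 * q ^ 3) = -10 * (-p / (b ^ 2 * q ^ 3)) := by ring
  have hδ0 : 0 < -p / (b ^ 2 * q ^ 3) := div_pos (by linarith) (by positivity)
  have e1 : 5 / b = 5 * (1 / b) := by ring
  have e2 : 20 / (b ^ 2 * q ^ 2) = 20 * (1 / (b ^ 2 * q ^ 2)) := by ring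
  rw [sq_mul_nearOne hP.ne', sq_mul_nearOne hP.ne', siteOne, hδ, e1, e2]
  apply Set.Ioo_subset_Ioo <;> linarith

theorem Ioo_subset_siteTwo (hb : 1 ≤ b) (hp : p ≤ -1) (hq : 3600 ≤ q)
    (hqp : 3600 * -p ≤ q ^ 3) :
    Set.Ioo ((b * q ^ 3 - p) ^ 2 * nearOne 100 (-(q / (b * q ^ 3 - p))))
      ((b * q ^ 3 - p) ^ 2 * nearOne 0 (-(q / (b * q ^ 3 - p)))) ⊆ siteTwo b p q := by
  have hq0 : 0 < q := by linarith
  have hP : 0 < b * q ^ 3 - p := by nlinarith [pow_pos hq0 3]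
  obtain ⟨h1, h2, h3, h4, h5⟩ := expansion_bounds hb (by linarith : 1 ≤ -p) hq hqp
  rw [← sub_eq_add_neg] at h1 h2 h3 h4 h5
  have hδ : 10 * p / (b ^ 2 * q ^ 3) = -10 * (-p / (b ^ 2 * q ^ 3)) := by ring
  have hδ0 : 0 < -p / (b ^ 2 * q ^ 3) := div_pos (by linarith) (by positivity)
  have e1 : 5 / b = 5 * (1 / b) := by ring
  have e2 : 20 / (b ^ 2 * q ^ 2) = 20 * (1 / (b ^ 2 * q ^ 2)) := by ring
  have e3 : (-q) ^ 3 / (b * q ^ 3 - p) = -(q ^ 3 / (b * q ^ 3 - p)) := by ring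
  have e4 : (-q) ^ 4 / (b * q ^ 3 - p) ^ 2 = q ^ 4 / (b * q ^ 3 - p) ^ 2 := by ring
  have e5 : (-q) ^ 5 / (b * q ^ 3 - p) ^ 3 = -(q ^ 5 / (b * q ^ 3 - p) ^ 3) := by ring
  rw [← neg_div, sq_mul_nearOne hP.ne', sq_mul_nearOne hP.ne', siteTwo, hδ, e1, e2, e3, e4, e5]
  apply Set.Ioo_subset_Ioo <;> linarith

theorem Ioo_subset_siteThree (hb : 1 ≤ b) (hp : p ≤ -1) (hq : 3600 ≤ q)
    (hqp : 3600 * -p ≤ q ^ 3) :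
    Set.Ioo ((b * q ^ 3 - p) ^ 2 * nearZero 0 (q / (b * q ^ 3 - p)))
      ((b * q ^ 3 - p) ^ 2 * nearZero 100 (q / (b * q ^ 3 - p))) ⊆ siteThree b p q := by
  have hq0 : 0 < q := by linarith
  have hP : 0 < b * q ^ 3 - p := by nlinarith [pow_pos hq0 3]
  obtain ⟨h1, h2, h3, h4, h5⟩ := expansion_bounds hb (by linarith : 1 ≤ -p) hq hqp
  rw [← sub_eq_add_neg] at h1 h2 h3 h4 h5
  have hδ : 32 * p / (b ^ 2 * q ^ 3) = -32 * (-p / (b ^ 2 * q ^ 3)) := by ring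
  have hδ0 : 0 < -p / (b ^ 2 * q ^ 3) := div_pos (by linarith) (by positivity)
  have e1 : 16 / b = 16 * (1 / b) := by ring
  rw [sq_mul_nearZero hP.ne', sq_mul_nearZero hP.ne', siteThree, hδ, e1]
  apply Set.Ioo_subset_Ioo <;> linarith

/-- Points separating the three sites from each other and from zero. -/
theorem sites_separated (hb : 1 ≤ b) (hp : p ≤ -1) (hq : 3600 ≤ q)
    (hqp : 3600 * -p ≤ q ^ 3) :
    (∀ t ∈ siteThree b p q, 0 < t) ∧
    (∀ s ∈ siteThree b p q, ∀ t ∈ siteTwo b p q, s < t) ∧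
    (∀ s ∈ siteTwo b p q, ∀ t ∈ siteOne b p q, s < t) := by
  have hq0 : 0 < q := by linarith
  have hb0 : 0 < b := by linarith
  have hq3 : 3600 * q ≤ q ^ 3 := by nlinarith [mul_pos hq0 hq0]
  have hP : 3600 * q ≤ b * q ^ 3 - p := by nlinarith [pow_pos hq0 3]
  have hδ0 : 0 < -p / (b ^ 2 * q ^ 3) := div_pos (by linarith) (by positivity)
  have hδ1 : -p / (b ^ 2 * q ^ 3) ≤ 1 := by
    rw [div_le_one (by positivity)]
    nlinarith [pow_pos hq0 3, one_le_pow₀ hb (n := 2)]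
  have hδ' : 10 * p / (b ^ 2 * q ^ 3) = -10 * (-p / (b ^ 2 * q ^ 3)) := by ring
  have hδ : 32 * p / (b ^ 2 * q ^ 3) = -32 * (-p / (b ^ 2 * q ^ 3)) := by ring
  have e1 : 5 / b = 5 * (1 / b) := by ring
  have e2 : 20 / (b ^ 2 * q ^ 2) = 20 * (1 / (b ^ 2 * q ^ 2)) := by ring
  have e3 : 16 / b = 16 * (1 / b) := by ring
  have hb1 : 1 / b ≤ 1 := by rw [div_le_one hb0]; exact hb
  have hb2 : 0 < 1 / b := by positivity
  have hc0 : 0 < 1 / (b ^ 2 * q ^ 2) := by positivity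
  have hc1 : 1 / (b ^ 2 * q ^ 2) ≤ 1 := by
    rw [div_le_one (by positivity)]
    nlinarith [one_le_pow₀ hb (n := 2), one_le_pow₀ (by linarith : 1 ≤ q) (n := 2)]
  -- With P = b q³ - p, the sites lie near Pq, P² - 2Pq - 2q² and P² + 2Pq - 2q². Since P ≥ 3600q,
  -- the gaps dwarf the bounded corrections.
  have hPq : 3600 * q * q ≤ (b * q ^ 3 - p) * q := by gcongr
  have hPP : 3600 * q * (b * q ^ 3 - p) ≤ (b * q ^ 3 - p) * (b * q ^ 3 - p) := by
    apply mul_le_mul_of_nonneg_right hP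
    nlinarith
  have hqq : 3600 * 3600 ≤ q * q := by nlinarith
  simp only [siteOne, siteTwo, siteThree, Set.mem_Ioo, hδ, hδ', e1, e2, e3]
  refine ⟨fun t ht => ?_, fun s hs t ht => ?_, fun s hs t ht => ?_⟩ <;> nlinarith

end

theorem theorem6p1 (B : ℕ) (hB1 : 1 ≤ B) (hB9 : B ≤ 9) (p : ℤ) (hp : p < 0)
    (q : ℝ) (hq : 3600 * |(p : ℝ)| ^ (1 / 3 : ℝ) ≤ q) :
    (selectedRoots B p q).ncard = 5 ∧
    (∀ t ∈ selectedRoots B p q,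
      ((cuboidPolyTilde B p q).map (algebraMap ℝ ℂ)).rootMultiplicity t = 1) ∧
    (∃ t₁ t₂ t₃ : ℝ,
      {t : ℝ | 0 < t ∧ (cuboidPolyTilde B p q).IsRoot t} = {t₁, t₂, t₃} ∧
      t₁ ∈ siteOne B p q ∧ t₂ ∈ siteTwo B p q ∧ t₃ ∈ siteThree B p q) ∧
    Disjoint (siteOne B p q) (siteTwo B p q) ∧
    Disjoint (siteOne B p q) (siteThree B p q) ∧
    Disjoint (siteTwo B p q) (siteThree B p q) := by
  have hb : (1 : ℝ) ≤ B := by exact_mod_cast hB1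
  have hp1 : (p : ℝ) ≤ -1 := by exact_mod_cast (by omega : p ≤ -1)
  have habs : |(p : ℝ)| = -p := abs_of_neg (by linarith)
  have hroot : 1 ≤ |(p : ℝ)| ^ (1 / 3 : ℝ) :=
    Real.one_le_rpow (by rw [habs]; linarith) (by norm_num)
  have hcube : (|(p : ℝ)| ^ (1 / 3 : ℝ)) ^ 3 = -p := by
    rw [← Real.rpow_natCast, ← Real.rpow_mul (abs_nonneg _)]
    norm_num [habs]
  have hq1 : 3600 ≤ q := by linarith
  have hqp : 3600 * -(p : ℝ) ≤ q ^ 3 := by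
    have : (3600 * |(p : ℝ)| ^ (1 / 3 : ℝ)) ^ 3 ≤ q ^ 3 := by gcongr
    rw [mul_pow, hcube] at this
    nlinarith
  have hq0 : 0 < q := by linarith
  have hPq : 1000000 * q ≤ B * q ^ 3 - p := by
    have : 1000000 * q ≤ q ^ 3 := by nlinarith [mul_pos hq0 hq0]
    nlinarith [pow_pos hq0 3]
  have hP : 0 < B * q ^ 3 - (p : ℝ) := by linarith
  have hx : q / (B * q ^ 3 - p) ≤ 1 / 1000000 := by
    rw [div_le_div_iff₀ hP (by norm_num)]
    linarith
  obtain ⟨t₁, t₂, t₃, y₁, y₂, h₁, h₂, h₃, hy₁, hy, e₁, e₂, e₃, f₁, f₂⟩ :=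
    exists_cuboidPoly_roots hP (div_pos hq0 hP) hx
  rw [mul_div_cancel₀ q hP.ne'] at e₁ e₂ e₃ f₁ f₂
  replace h₁ := Ioo_subset_siteOne hb hp1 hq1 hqp h₁
  replace h₂ := Ioo_subset_siteTwo hb hp1 hq1 hqp h₂
  replace h₃ := Ioo_subset_siteThree hb hp1 hq1 hqp h₃
  obtain ⟨s₃, s₂₃, s₁₂⟩ := sites_separated hb hp1 hq1 hqp
  have h3 := s₃ _ h₃
  have h32 := s₂₃ _ h₃ _ h₂
  have h21 := s₁₂ _ h₂ _ h₁
  have hroots := cuboidPoly_map_roots_eq h3 h32 h21 hy₁ hy e₁ e₂ e₃ f₁ f₂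
  have hmem : ∀ t, ((cuboidPolyTilde B p q).map (algebraMap ℝ ℂ)).IsRoot t ↔
      t ∈ tenPoints t₁ t₂ t₃ y₁ y₂ := fun t => by
    rw [← Finset.mem_val, ← hroots, mem_roots ((Polynomial.map_ne_zero_iff
      (algebraMap ℝ ℂ).injective).2 (cuboidPoly_ne_zero _ q)), cuboidPolyTilde]
  refine ⟨?_, fun t ht => ?_, ⟨t₁, t₂, t₃, ?_, h₁, h₂, h₃⟩, ?_, ?_, ?_⟩
  · simp only [selectedRoots, hmem]
    rw [tenPoints_filter_isSelected h3 h32 h21 hy₁ hy, Set.ncard_coe_finset,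
      card_selected_tenPoints h3 h32 h21 hy]
  · rw [← count_roots, cuboidPolyTilde, hroots]
    exact Multiset.count_eq_one_of_mem (Finset.nodup _) ((hmem t).1 ht.1)
  · exact setOf_pos_isRoot_eq h3 h32 h21 hroots
  · exact Set.disjoint_left.2 fun t h h' => lt_irrefl t (s₁₂ t h' t h)
  -- The root t₂ serves as a point of the middle site between the outer two.
  · exact Set.disjoint_left.2 fun t h h' =>
      lt_irrefl t (((s₂₃ t h' t₂ h₂).trans (s₁₂ t₂ h₂ t h)))
  · exact Set.disjoint_left.2 fun t h h' => lt_irrefl t (s₂₃ t h' t h)
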